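/- **Proposition 3.7 (strong duality for distributionally robust optimization with linear models).** Let $\|\cdot\|$ be an arbitrary norm on $\mathbb{R}^d$, with dual norm $\|\theta\|_*=\sup\{\langle x,\theta\rangle:\|x\|\le 1\}$, let $p\ge 1$ be a real number, and let $c(z,\hat z)=\|z-\hat z\|^p$. For Borel probability measures $Q,P$ on $\mathbb{R}^d$ put $$d_c(Q,P)=\inf_{\pi\in\Pi(Q,P)}\int c(z,\hat z)\,d\pi(z,\hat z)\in[0,+\infty],$$ where $\Pi(Q,P)$ is the set of all joint distributions with marginals $Q$ and $P$. Fix a Borel probability measure $\hat P$ on $\mathbb{R}^d$ and a radius $\varepsilon>0$, and let $B_\varepsilon(\hat P)$ be the set of all Borel probability measures $Q$ on $\mathbb{R}^d$ with $d_c(Q,\hat P)\le\varepsilon$. Let $L:\mathbb{R}\to[-\infty,+\infty]$ be proper (that is, $L>-\infty$ everywhere and $L\not\equiv+\infty$) and upper semicontinuous, and assume that there is a constant $C\ge 0$ with $L(s)\le C(1+|s|^p)$ for all $s\in\mathbb{R}$. Define the $p$-th envelope of $L$ by $$L_p(s,\lambda)=\sup_{s'\in\mathbb{R}}\; L(s')-\lambda|s-s'|^p\in[-\infty,+\infty],\qquad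 s\in\mathbb{R},\ \lambda\ge 0 .$$ Then, for every $\theta\in\mathbb{R}^d$ such that $\hat z\mapsto L(\langle\theta,\hat z\rangle)$ is $\hat P$-integrable, $$\sup_{Q\in B_\varepsilon(\hat P)}\mathbb{E}_{Z\sim Q}\big[L(\langle\theta,Z\rangle)\big]\;=\;\inf_{\lambda\ge 0}\;\lambda\,\varepsilon\,\|\theta\|_*^p+\mathbb{E}_{\hat Z\sim\hat P}\big[L_p(\langle\theta,\hat Z\rangle,\lambda)\big].$$ This is an equality in $[-\infty,+\infty]$, where $\mathbb{E}[f]=\mathbb{E}[\max\{f,0\}]-\mathbb{E}[\max\{-f,0\}]$ for extended real-valued $f$, with the convention $\infty-\infty=-\infty$. -/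

import Mathlib

open MeasureTheory
open scoped ENNReal InnerProductSpace

noncomputable section

namespace DRO

/-- The expectation of an extended real-valued function, `E[f⁺] - E[f⁻]`, which is an element of
`[-∞, +∞]`. It agrees with the usual one whenever `E[f⁺]` or `E[f⁻]` is finite; if both are
infinite, then the value is `-∞` (in `EReal`, `⊤ - ⊤ = ⊥`). -/
def expectation {Z : Type*} [MeasurableSpace Z] (μ : Measure Z) (f : Z → EReal) : EReal :=
  ((∫⁻ z, (f z).toENNReal ∂μ : ℝ≥0∞) : EReal) - ((∫⁻ z, (-f z).toENNReal ∂μ : ℝ≥0∞) : EReal)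

/-- `μ`-integrability of an extended real-valued function: it is measurable and its absolute
value has a finite expectation. -/
def IsIntegrable {Z : Type*} [MeasurableSpace Z] (μ : Measure Z) (f : Z → EReal) : Prop :=
  AEMeasurable f μ ∧ ∫⁻ z, (f z).abs ∂μ < ∞

/-- The couplings of `Q` and `P`: the joint distributions with marginals `Q` and `P`. -/
def couplings {Z : Type*} [MeasurableSpace Z] (Q P : ProbabilityMeasure Z) :
    Set (ProbabilityMeasure (Z × Z)) :=
  {π | (π : Measure (Z × Z)).map Prod.fst = (Q : Measure Z) ∧
    (π : Measure (Z × Z)).map Prod.snd = (P : Measure Z)}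

/-- The optimal transport discrepancy `d_c(Q, P)` with transportation cost `c`. -/
def otDiscrepancy {Z : Type*} [MeasurableSpace Z] (c : Z → Z → ℝ≥0∞)
    (Q P : ProbabilityMeasure Z) : ℝ≥0∞ :=
  ⨅ π ∈ couplings Q P, ∫⁻ w, c w.1 w.2 ∂(π : Measure (Z × Z))

/-- The ambiguity set: the distributions whose optimal transport discrepancy from the reference
distribution `P` is at most `ε`. -/
def ambiguitySet {Z : Type*} [MeasurableSpace Z] (c : Z → Z → ℝ≥0∞)
    (P : ProbabilityMeasure Z) (ε : ℝ) : Set (ProbabilityMeasure Z) :=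
  {Q | otDiscrepancy c Q P ≤ ENNReal.ofReal ε}

/-- The transportation cost `c(z, z') = N(z - z') ^ p`. -/
def normCost {d : ℕ} (N : Seminorm ℝ (EuclideanSpace ℝ (Fin d))) (p : ℝ)
    (z z' : EuclideanSpace ℝ (Fin d)) : ℝ≥0∞ :=
  ENNReal.ofReal (N (z - z') ^ p)

/-- The dual norm `‖y‖_* = sup {⟨x, y⟩ : N(x) ≤ 1}`; the set is nonempty, and it is bounded
when `N` is a norm. -/
def dualNorm {d : ℕ} (N : Seminorm ℝ (EuclideanSpace ℝ (Fin d)))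
    (y : EuclideanSpace ℝ (Fin d)) : ℝ :=
  sSup {r : ℝ | ∃ x : EuclideanSpace ℝ (Fin d), N x ≤ 1 ∧ r = ⟪x, y⟫_ℝ}

/-- A function into `[-∞, +∞]` is proper if it never takes the value `-∞` and is not
identically `+∞`. -/
def IsProper {X : Type*} (f : X → EReal) : Prop :=
  (∀ x, f x ≠ ⊥) ∧ ∃ x, f x ≠ ⊤

/-- The `p`-th envelope `L_p(s, lam) = sup_{s'} L(s') - lam |s - s'| ^ p`. -/
def envelope (L : ℝ → EReal) (p : ℝ) (s lam : ℝ) : EReal :=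
  ⨆ s' : ℝ, L s' - ((lam * |s - s'| ^ p : ℝ) : EReal)

end DRO

end

namespace DRO

/-! ### Expectations of extended real-valued functions -/

/-! Write `D` for the dual norm of `θ`. Growth and properness make `L` real-valued. Weak duality
integrates `L ⟪θ, z⟫ ≤ L_p(⟪θ, z'⟫, lam) + lam * D ^ p * N (z - z') ^ p` over a nearly optimal
coupling (`expectation_le_of_mem_ambiguitySet`).

For the converse with `θ ≠ 0`, the attainable pairs (budget, expected loss) form a convex planar
set, because couplings with second marginal `P` can be mixed. If the primal value `V` is finite,
this set has a supporting line at budget `ε` of slope `lam ≥ 0` (`exists_supergradient`); it is not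
vertical because budget `0 < ε` is attainable. A map `T` of the scalar `⟪θ, z⟫` lifts to a
displacement along a vector attaining `D`, at cost at most `|s - T s| ^ p / D ^ p`
(`mem_achievable_of_map`). The supporting line thus bounds `∫ l ∘ T - (lam / D ^ p) ∫ |s - T s| ^ p`
by `V - lam * ε` for all admissible `T`, and measurable near-maximizers carry this bound over to the
envelope (`expectation_envelope_le`).

For `θ = 0` the penalty vanishes, and a large `lam` brings the envelope at `0` down to `L 0`
(`exists_envelope_zero_le`). -/

lemma expectation_map {Y Z : Type*} [MeasurableSpace Y] [MeasurableSpace Z] {μ : Measure Y}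
    {g : Y → Z} (hg : Measurable g) {f : Z → EReal} (hf : Measurable f) :
    expectation (μ.map g) f = expectation μ (fun y => f (g y)) := by
  unfold expectation
  have hn : Measurable fun z => (-f z).toENNReal := hf.neg.ereal_toENNReal
  rw [lintegral_map hf.ereal_toENNReal hg, lintegral_map hn hg]

lemma lintegral_toENNReal_neg_ne_top {Z : Type*} [MeasurableSpace Z] {μ : Measure Z} {f : Z → ℝ}
    (hf : Integrable f μ) : ∫⁻ z, (-((f z : ℝ) : EReal)).toENNReal ∂μ ≠ ∞ := by
  simp only [← EReal.coe_neg, EReal.real_coe_toENNReal]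
  exact hf.neg.lintegral_lt_top.ne

lemma expectation_coe {Z : Type*} [MeasurableSpace Z] {μ : Measure Z} {f : Z → ℝ}
    (hf : Integrable f μ) : expectation μ (fun z => (f z : EReal)) = ((∫ z, f z ∂μ : ℝ) : EReal) := by
  rw [integral_eq_lintegral_pos_part_sub_lintegral_neg_part hf]
  unfold expectation
  simp only [← EReal.coe_neg, EReal.real_coe_toENNReal]
  rw [EReal.coe_sub, EReal.coe_ennreal_toReal, EReal.coe_ennreal_toReal]
  · exact hf.neg.lintegral_lt_top.ne
  · exact hf.lintegral_lt_top.ne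

/-- Moving the negative parts across turns `x⁺ - x⁻ ≤ y⁺ - y⁻ + h` into an inequality in `[0, ∞]`,
which can be integrated without meeting `∞ - ∞`. -/
lemma toENNReal_add_toENNReal_neg_le {x y : EReal} {h : ℝ≥0∞} (hxy : x ≤ y + h) :
    x.toENNReal + (-y).toENNReal ≤ y.toENNReal + (-x).toENNReal + h := by
  induction h with
  | top => simp
  | coe h =>
    induction y with
    | top => simp
    | bot =>
      have : x = ⊥ := by simpa using hxy
      simp [this]
    | coe y =>
      induction x with
      | bot => simp
      | top =>
        exfalso
        have : ((y : EReal) + ((h : ℝ≥0∞) : EReal)) = ((y + h : ℝ) : EReal) := rfl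
        rw [this] at hxy
        exact absurd hxy (EReal.coe_lt_top _).not_ge
      | coe x =>
        have hxy' : x ≤ y + h := EReal.coe_le_coe_iff.1 hxy
        simp only [← EReal.coe_neg, EReal.real_coe_toENNReal]
        rw [← ENNReal.ofReal_coe_nnreal (p := h)]
        simp only [ENNReal.ofReal]
        norm_cast
        rw [← NNReal.coe_le_coe]
        push_cast
        simp only [Real.coe_toNNReal', NNReal.coe_nonneg, max_eq_left]
        rcases max_cases x 0 with ⟨h1, _⟩ | ⟨h1, _⟩ <;>
        rcases max_cases y 0 with ⟨h2, _⟩ | ⟨h2, _⟩ <;>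
        rcases max_cases (-x) 0 with ⟨h3, _⟩ | ⟨h3, _⟩ <;>
        rcases max_cases (-y) 0 with ⟨h4, _⟩ | ⟨h4, _⟩ <;>
        rw [h1, h2, h3, h4] <;> linarith [h.coe_nonneg]

/-- Finiteness of `∫ g⁻` keeps the convention `⊤ - ⊤ = ⊥` from collapsing the right-hand side; on
the left that convention is harmless. -/
lemma expectation_le_add_lintegral {Z : Type*} [MeasurableSpace Z] {μ : Measure Z}
    {f g : Z → EReal} {h : Z → ℝ≥0∞} (hf : Measurable f) (hg : Measurable g)
    (hfg : ∀ z, f z ≤ g z + h z) (hfin : ∫⁻ z, (-g z).toENNReal ∂μ ≠ ∞) :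
    expectation μ f ≤ expectation μ g + ((∫⁻ z, h z ∂μ : ℝ≥0∞) : EReal) := by
  have key : ∫⁻ z, (f z).toENNReal ∂μ + ∫⁻ z, (-g z).toENNReal ∂μ ≤
      ∫⁻ z, (g z).toENNReal ∂μ + ∫⁻ z, (-f z).toENNReal ∂μ + ∫⁻ z, h z ∂μ := by
    have hs : Measurable fun z => (g z).toENNReal + (-f z).toENNReal :=
      hg.ereal_toENNReal.add hf.neg.ereal_toENNReal
    rw [← lintegral_add_left hf.ereal_toENNReal, ← lintegral_add_left hg.ereal_toENNReal,
      ← lintegral_add_left hs]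
    exact lintegral_mono fun z => toENNReal_add_toENNReal_neg_le (hfg z)
  unfold expectation
  generalize ∫⁻ z, (f z).toENNReal ∂μ = a at *
  generalize ∫⁻ z, (-g z).toENNReal ∂μ = b at *
  generalize ∫⁻ z, (g z).toENNReal ∂μ = c at *
  generalize ∫⁻ z, (-f z).toENNReal ∂μ = e at *
  generalize ∫⁻ z, h z ∂μ = k at *
  lift b to NNReal using hfin
  induction e with
  | top => simp
  | coe e =>
    induction k with
    | top =>
      have : (c : EReal) - ((b : ℝ≥0∞) : EReal) ≠ ⊥ := by
        induction c with
        | top => exact ne_of_eq_of_ne (EReal.top_sub_coe (b : ℝ)) (by simp)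
        | coe c => exact EReal.coe_ne_bot ((c : ℝ) - b)
      rw [EReal.coe_ennreal_top, EReal.add_top_of_ne_bot this]
      exact le_top
    | coe k =>
      induction c with
      | top =>
        have : ((∞ : ℝ≥0∞) : EReal) - ((b : ℝ≥0∞) : EReal) + ((k : ℝ≥0∞) : EReal) = ⊤ := by
          rw [EReal.coe_ennreal_top, show (⊤ : EReal) - ((b : ℝ≥0∞) : EReal) = ⊤ from
            EReal.top_sub_coe (b : ℝ)]
          exact EReal.top_add_coe (k : ℝ)
        rw [this]
        exact le_top
      | coe c =>
        induction a with
        | top => simp at key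
        | coe a =>
          norm_cast at key
          rw [← NNReal.coe_le_coe] at key
          push_cast at key
          change (((a : ℝ) - e : ℝ) : EReal) ≤ (((c : ℝ) - b + k : ℝ) : EReal)
          exact EReal.coe_le_coe_iff.2 (by linarith)

/-! ### Envelopes -/

/-- The supremum is uncountable, but each term is continuous in `s`, so the envelope is lower
semicontinuous. -/
lemma measurable_envelope (L : ℝ → EReal) (hL : ∀ s, L s ≠ ⊥ ∧ L s ≠ ⊤) {p : ℝ} (hp : 0 ≤ p)
    (lam : ℝ) : Measurable fun s => envelope L p s lam := by
  refine LowerSemicontinuous.measurable (lowerSemicontinuous_iSup fun s' => ?_)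
  refine Continuous.lowerSemicontinuous ?_
  have : ∀ s : ℝ, L s' - ((lam * |s - s'| ^ p : ℝ) : EReal) =
      (((L s').toReal - lam * |s - s'| ^ p : ℝ) : EReal) := fun s => by
    rw [EReal.coe_sub, EReal.coe_toReal (hL s').2 (hL s').1]
  simp only [this]
  exact continuous_coe_real_ereal.comp (by fun_prop (disch := simp [hp]))

lemma le_envelope (L : ℝ → EReal) {p : ℝ} (hp : 0 < p) (s lam : ℝ) : L s ≤ envelope L p s lam := by
  refine le_trans ?_ (le_iSup _ s)
  simp [Real.zero_rpow hp.ne']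

lemma le_envelope_add (L : ℝ → EReal) (p s s' lam : ℝ) (hlam : 0 ≤ lam) :
    L s' ≤ envelope L p s lam + (ENNReal.ofReal (lam * |s - s'| ^ p) : EReal) := by
  have h1 : L s' - ((lam * |s - s'| ^ p : ℝ) : EReal) ≤ envelope L p s lam :=
    le_iSup (fun s' => L s' - ((lam * |s - s'| ^ p : ℝ) : EReal)) s'
  rw [EReal.coe_ennreal_ofReal, max_eq_left (by positivity)]
  rwa [EReal.sub_le_iff_le_add (Or.inl (EReal.coe_ne_bot _)) (Or.inl (EReal.coe_ne_top _))] at h1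

/-! ### Weak duality -/

lemma expectation_le_of_mem_couplings {d : ℕ} {N : Seminorm ℝ (EuclideanSpace ℝ (Fin d))} {p D : ℝ}
    (hp : 1 ≤ p) (hD : 0 ≤ D) {θ : EuclideanSpace ℝ (Fin d)}
    (hθ : ∀ x, |⟪θ, x⟫_ℝ| ≤ D * N x) {L : ℝ → EReal} (hL : ∀ s, L s ≠ ⊥ ∧ L s ≠ ⊤)
    (hLm : Measurable L) {lam : ℝ} (hlam : 0 ≤ lam)
    {Q P : ProbabilityMeasure (EuclideanSpace ℝ (Fin d))}
    (hfin : ∫⁻ z, (-L ⟪θ, z⟫_ℝ).toENNReal ∂(P : Measure (EuclideanSpace ℝ (Fin d))) ≠ ∞)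
    {π : ProbabilityMeasure (EuclideanSpace ℝ (Fin d) × EuclideanSpace ℝ (Fin d))}
    (hπ : π ∈ couplings Q P) :
    expectation (Q : Measure (EuclideanSpace ℝ (Fin d))) (fun z => L ⟪θ, z⟫_ℝ) ≤
      expectation (P : Measure (EuclideanSpace ℝ (Fin d))) (fun z => envelope L p ⟪θ, z⟫_ℝ lam) +
      ((ENNReal.ofReal (lam * D ^ p) *
        ∫⁻ w, normCost N p w.1 w.2 ∂(π : Measure (_ × _)) : ℝ≥0∞) : EReal) := by
  have hi : Measurable fun z : EuclideanSpace ℝ (Fin d) => ⟪θ, z⟫_ℝ :=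
    (continuous_const.inner continuous_id).measurable
  have hE : Measurable fun z : EuclideanSpace ℝ (Fin d) => envelope L p ⟪θ, z⟫_ℝ lam :=
    (measurable_envelope L hL (by linarith) lam).comp hi
  have hF : Measurable fun z : EuclideanSpace ℝ (Fin d) => L ⟪θ, z⟫_ℝ := hLm.comp hi
  have h2 : ∫⁻ w, (-(envelope L p ⟪θ, w.2⟫_ℝ lam)).toENNReal
      ∂(π : Measure (EuclideanSpace ℝ (Fin d) × EuclideanSpace ℝ (Fin d))) ≠ ∞ := by
    have hn : Measurable fun z : EuclideanSpace ℝ (Fin d) => (-L ⟪θ, z⟫_ℝ).toENNReal :=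
      hF.neg.ereal_toENNReal
    rw [← hπ.2, lintegral_map hn measurable_snd] at hfin
    refine ne_top_of_le_ne_top hfin (lintegral_mono fun w => ?_)
    exact EReal.toENNReal_le_toENNReal (EReal.neg_le_neg_iff.2 (le_envelope L (by linarith) _ _))
  rw [← hπ.1, ← hπ.2, expectation_map measurable_fst hF, expectation_map measurable_snd hE,
    ← lintegral_const_mul' _ _ ENNReal.ofReal_ne_top]
  refine expectation_le_add_lintegral (hF.comp measurable_fst) (hE.comp measurable_snd)
    (fun w => ?_) h2
  refine (le_envelope_add L p ⟪θ, w.2⟫_ℝ ⟪θ, w.1⟫_ℝ lam hlam).trans ?_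
  refine add_le_add_right (EReal.coe_ennreal_le_coe_ennreal_iff.2 ?_) _
  rw [normCost, ← ENNReal.ofReal_mul (by positivity)]
  refine ENNReal.ofReal_le_ofReal ?_
  rw [mul_assoc, ← Real.mul_rpow hD (apply_nonneg N _)]
  have := hθ (w.1 - w.2)
  rw [inner_sub_right, abs_sub_comm] at this
  gcongr

lemma expectation_ne_bot {Z : Type*} [MeasurableSpace Z] {μ : Measure Z} {f : Z → EReal}
    (hfin : ∫⁻ z, (-f z).toENNReal ∂μ ≠ ∞) : expectation μ f ≠ ⊥ := by
  unfold expectation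
  generalize ∫⁻ z, (f z).toENNReal ∂μ = c at *
  generalize ∫⁻ z, (-f z).toENNReal ∂μ = b at *
  lift b to NNReal using hfin
  induction c with
  | top => exact ne_of_eq_of_ne (EReal.top_sub_coe (b : ℝ)) (by simp)
  | coe c => exact EReal.coe_ne_bot ((c : ℝ) - b)

theorem expectation_le_of_mem_ambiguitySet {d : ℕ} {N : Seminorm ℝ (EuclideanSpace ℝ (Fin d))}
    {p D : ℝ} (hp : 1 ≤ p) (hD : 0 ≤ D) {θ : EuclideanSpace ℝ (Fin d)}
    (hθ : ∀ x, |⟪θ, x⟫_ℝ| ≤ D * N x) {L : ℝ → EReal} (hL : ∀ s, L s ≠ ⊥ ∧ L s ≠ ⊤)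
    (hLm : Measurable L) {lam ε : ℝ} (hlam : 0 ≤ lam) (hε : 0 < ε)
    {Q P : ProbabilityMeasure (EuclideanSpace ℝ (Fin d))}
    (hfin : ∫⁻ z, (-L ⟪θ, z⟫_ℝ).toENNReal ∂(P : Measure (EuclideanSpace ℝ (Fin d))) ≠ ∞)
    (hQ : Q ∈ ambiguitySet (normCost N p) P ε) :
    expectation (Q : Measure (EuclideanSpace ℝ (Fin d))) (fun z => L ⟪θ, z⟫_ℝ) ≤
      ((lam * ε * D ^ p : ℝ) : EReal) + expectation (P : Measure (EuclideanSpace ℝ (Fin d)))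
        (fun z => envelope L p ⟪θ, z⟫_ℝ lam) := by
  -- An optimal coupling need not be available, so one of cost below `ε + η` is used and `η` tends
  -- to `0`.
  have hlt : ∀ η : ℝ, 0 < η →
      expectation (Q : Measure (EuclideanSpace ℝ (Fin d))) (fun z => L ⟪θ, z⟫_ℝ) ≤
      expectation (P : Measure (EuclideanSpace ℝ (Fin d)))
        (fun z => envelope L p ⟪θ, z⟫_ℝ lam) + ((lam * D ^ p * (ε + η) : ℝ) : EReal) := by
    intro η hη
    have h1 : otDiscrepancy (normCost N p) Q P < ENNReal.ofReal (ε + η) :=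
      lt_of_le_of_lt hQ ((ENNReal.ofReal_lt_ofReal_iff (by linarith)).2 (by linarith))
    unfold otDiscrepancy at h1
    simp only [iInf_lt_iff] at h1
    obtain ⟨π, hπ, hc⟩ := h1
    refine (expectation_le_of_mem_couplings hp hD hθ hL hLm hlam hfin hπ).trans ?_
    refine add_le_add_right ?_ _
    have h3 : ((lam * D ^ p * (ε + η) : ℝ) : EReal) =
        ((ENNReal.ofReal (lam * D ^ p) * ENNReal.ofReal (ε + η) : ℝ≥0∞) : EReal) := by
      rw [← ENNReal.ofReal_mul (by positivity), EReal.coe_ennreal_ofReal,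
        max_eq_left (by positivity)]
    rw [h3]
    exact EReal.coe_ennreal_le_coe_ennreal_iff.2 (by gcongr)
  have hbot : expectation (P : Measure (EuclideanSpace ℝ (Fin d)))
      (fun z => envelope L p ⟪θ, z⟫_ℝ lam) ≠ ⊥ := by
    refine expectation_ne_bot (ne_top_of_le_ne_top hfin (lintegral_mono fun w => ?_))
    exact EReal.toENNReal_le_toENNReal (EReal.neg_le_neg_iff.2 (le_envelope L (by linarith) _ _))
  generalize expectation (P : Measure (EuclideanSpace ℝ (Fin d)))
      (fun z => envelope L p ⟪θ, z⟫_ℝ lam) = e at *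
  generalize expectation (Q : Measure (EuclideanSpace ℝ (Fin d))) (fun z => L ⟪θ, z⟫_ℝ) = r at *
  induction e with
  | bot => exact absurd rfl hbot
  | top => rw [EReal.add_top_of_ne_bot (EReal.coe_ne_bot _)]; exact le_top
  | coe e =>
    induction r with
    | bot => simp
    | top =>
      have := hlt 1 one_pos
      rw [← EReal.coe_add] at this
      exact absurd this (EReal.coe_lt_top _).not_ge
    | coe r =>
      norm_cast at hlt ⊢
      refine le_of_forall_pos_le_add fun δ hδ => ?_
      set A := lam * D ^ p with hA
      have hA0 : 0 ≤ A := by positivity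
      -- The `+ 1` covers `A = 0`.
      have h1 := hlt (δ / (A + 1)) (by positivity)
      have h2 : A * (δ / (A + 1)) ≤ δ := by
        rw [← mul_div_assoc, div_le_iff₀ (by positivity)]
        nlinarith
      have h3 : lam * ε * D ^ p = A * ε := by rw [hA]; ring
      rw [h3]
      linarith [mul_add A ε (δ / (A + 1))]

/-! ### Measurable near-maximizers -/

/-- The greedy maximizers: starting from the identity, move `s` to the candidate `t k` when
`|s| ≤ j` and this increases `v s`, the pairs `(k, j)` being enumerated by `Nat.unpair`. -/
noncomputable def greedy (v : ℝ → ℝ → ℝ) (t : ℕ → ℝ) : ℕ → ℝ → ℝ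
  | 0 => fun s => s
  | n + 1 => fun s =>
    if |s| ≤ (n.unpair.2 : ℝ) ∧ v s (greedy v t n s) < v s (t n.unpair.1)
      then t n.unpair.1 else greedy v t n s

lemma monotone_greedy (v : ℝ → ℝ → ℝ) (t : ℕ → ℝ) (s : ℝ) :
    Monotone fun n => v s (greedy v t n s) := by
  refine monotone_nat_of_le_succ fun n => ?_
  simp only [greedy]
  split_ifs with h
  · exact h.2.le
  · exact le_rfl

lemma exists_le_greedy (v : ℝ → ℝ → ℝ) (t : ℕ → ℝ) (s : ℝ) (k : ℕ) :
    ∃ n, v s (t k) ≤ v s (greedy v t n s) := by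
  obtain ⟨j, hj⟩ := exists_nat_ge |s|
  refine ⟨Nat.pair k j + 1, ?_⟩
  simp only [greedy, Nat.unpair_pair]
  split_ifs with h
  · exact le_rfl
  · by_contra! h2
    exact h ⟨hj, h2⟩

lemma measurableSet_greedy {v : ℝ → ℝ → ℝ} (hv : Measurable (Function.uncurry v)) {T : ℝ → ℝ}
    (hT : Measurable T) (j : ℕ) (a : ℝ) :
    MeasurableSet {s : ℝ | |s| ≤ (j : ℝ) ∧ v s (T s) < v s a} := by
  have h1 : Measurable fun s : ℝ => |s| := continuous_abs.measurable
  exact (measurableSet_le h1 measurable_const).inter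
    (measurableSet_lt (hv.comp (measurable_id.prodMk hT))
      (hv.comp (measurable_id.prodMk measurable_const)))

lemma measurable_greedy {v : ℝ → ℝ → ℝ} (hv : Measurable (Function.uncurry v)) (t : ℕ → ℝ)
    (n : ℕ) : Measurable (greedy v t n) := by
  induction n with
  | zero => exact measurable_id
  | succ n ih => exact Measurable.ite (measurableSet_greedy hv ih _ _) measurable_const ih

/-- A move happens only where `|s| ≤ j`; this cutoff bounds the displacement and hence makes the
transport cost integrable. -/
lemma exists_abs_sub_greedy_le (v : ℝ → ℝ → ℝ) (t : ℕ → ℝ) (n : ℕ) :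
    ∃ M, ∀ s, |s - greedy v t n s| ≤ M := by
  induction n with
  | zero => exact ⟨0, fun s => by simp [greedy]⟩
  | succ n ih =>
    obtain ⟨M, hM⟩ := ih
    refine ⟨max M (n.unpair.2 + |t n.unpair.1|), fun s => ?_⟩
    simp only [greedy]
    split_ifs with h
    · exact le_max_of_le_right ((abs_sub _ _).trans (by linarith [h.1]))
    · exact le_max_of_le_left (hM s)

lemma integrable_comp_greedy {v : ℝ → ℝ → ℝ} (hv : Measurable (Function.uncurry v)) (t : ℕ → ℝ)
    {ρ : Measure ℝ} [IsFiniteMeasure ρ] {l : ℝ → ℝ} (hl : Integrable l ρ) (n : ℕ) :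
    Integrable (fun s => l (greedy v t n s)) ρ := by
  classical
  induction n with
  | zero => exact hl
  | succ n ih =>
    have := Integrable.piecewise
      (measurableSet_greedy hv (measurable_greedy hv t n) n.unpair.2 (t n.unpair.1)) (f := fun _ => l (t n.unpair.1)) (μ := ρ)
      (integrable_const _).integrableOn ih.integrableOn
    refine this.congr (Filter.Eventually.of_forall fun s => ?_)
    simp only [greedy, Set.piecewise, Set.mem_ofPred_eq]
    split_ifs <;> rfl

lemma integrable_abs_sub_rpow {ρ : Measure ℝ} [IsFiniteMeasure ρ] {T : ℝ → ℝ} (hT : Measurable T)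
    {M : ℝ} (hM : ∀ s, |s - T s| ≤ M) {p : ℝ} (hp : 0 ≤ p) :
    Integrable (fun s => |s - T s| ^ p) ρ := by
  refine Integrable.of_bound (by fun_prop) (M ^ p) (Filter.Eventually.of_forall fun s => ?_)
  rw [Real.norm_of_nonneg (by positivity)]
  exact Real.rpow_le_rpow (abs_nonneg _) (hM s) hp

/-- A dense sequence in `ℝ` would not control a discontinuous `l`; density in the graph, a separable
space, does. -/
lemma exists_seq_dense_graph (l : ℝ → ℝ) :
    ∃ t : ℕ → ℝ, ∀ (F : ℝ × ℝ → ℝ), Continuous F → ∀ (K : ℝ),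
      (∀ k, F (t k, l (t k)) ≤ K) → ∀ s, F (s, l s) ≤ K := by
  let G := Set.range fun s : ℝ => (s, l s)
  have : Nonempty G := ⟨⟨(0, l 0), ⟨0, rfl⟩⟩⟩
  obtain ⟨u, hu⟩ := TopologicalSpace.exists_dense_seq G
  refine ⟨fun n => (u n).1.1, fun F hF K hK s => ?_⟩
  have hc : IsClosed {g : G | F g.1 ≤ K} := isClosed_le (hF.comp continuous_subtype_val)
    continuous_const
  have hsub : Set.range u ⊆ {g : G | F g.1 ≤ K} := by
    rintro _ ⟨n, rfl⟩
    have h1 := hK n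
    obtain ⟨x, hx⟩ := (u n).2
    have h2 : (u n).1 = ((u n).1.1, l (u n).1.1) := by
      rw [← hx]
    change F (u n).1 ≤ K
    rw [h2]
    exact h1
  exact hc.closure_subset_iff.2 hsub (hu ⟨(s, l s), ⟨s, rfl⟩⟩)

/-- The expectation of the envelope is the supremum over measurable transport maps with bounded
displacement. -/
theorem expectation_envelope_le {ρ : Measure ℝ} [IsFiniteMeasure ρ] {l : ℝ → ℝ}
    (hlm : Measurable l) (hl : Integrable l ρ) {p : ℝ} (hp : 0 < p) (lam K : ℝ)
    (hK : ∀ T : ℝ → ℝ, Measurable T → (∃ M, ∀ s, |s - T s| ≤ M) →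
      Integrable (fun s => l (T s)) ρ → ∫ s, l (T s) ∂ρ - lam * ∫ s, |s - T s| ^ p ∂ρ ≤ K) :
    expectation ρ (fun s => envelope (fun s => (l s : EReal)) p s lam) ≤ K := by
  obtain ⟨t, ht⟩ := exists_seq_dense_graph l
  let v : ℝ → ℝ → ℝ := fun s s' => l s' - lam * |s - s'| ^ p
  have hv : Measurable (Function.uncurry v) := by
    simp only [v, Function.uncurry_def]
    fun_prop
  let T := greedy v t
  have hTm : ∀ n, Measurable (T n) := measurable_greedy hv t
  have hvint : ∀ n, Integrable (fun s => v s (T n s)) ρ := fun n => by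
    obtain ⟨M, hM⟩ := exists_abs_sub_greedy_le v t n
    exact (integrable_comp_greedy hv t hl n).sub
      ((integrable_abs_sub_rpow (hTm n) hM hp.le).const_mul lam)
  have hvle : ∀ n, ∫ s, v s (T n s) ∂ρ ≤ K := fun n => by
    obtain ⟨M, hM⟩ := exists_abs_sub_greedy_le v t n
    have h1 := hK (T n) (hTm n) ⟨M, hM⟩ (integrable_comp_greedy hv t hl n)
    rwa [← integral_const_mul, ← integral_sub (integrable_comp_greedy hv t hl n)
      ((integrable_abs_sub_rpow (hTm n) hM hp.le).const_mul lam)] at h1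
  have hv0 : ∀ s, v s (T 0 s) = l s := fun s => by
    simp [v, T, greedy, Real.zero_rpow hp.ne']
  -- The gain over the identity map `T 0` is nonnegative and increasing in `n`, so monotone
  -- convergence applies.
  let h : ℝ → ℝ≥0∞ := fun s => ⨆ n, ENNReal.ofReal (v s (T n s) - l s)
  have hh : ∫⁻ s, h s ∂ρ ≤ ENNReal.ofReal (K - ∫ s, l s ∂ρ) := by
    rw [lintegral_iSup]
    · refine iSup_le fun n => ?_
      have hd : Integrable (fun s => v s (T n s) - l s) ρ := (hvint n).sub hl
      rw [← ofReal_integral_eq_lintegral_ofReal hd, integral_sub (hvint n) hl]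
      · exact ENNReal.ofReal_le_ofReal (by linarith [hvle n])
      · refine Filter.Eventually.of_forall fun s => ?_
        have := monotone_greedy v t s (Nat.zero_le n)
        have h0 := hv0 s
        simp only [T] at h0
        simp only [Pi.zero_apply]
        simp only [T] at *
        linarith
    · intro n
      exact ((hv.comp (measurable_id.prodMk (hTm n))).sub hlm).ennreal_ofReal
    · intro m n hmn s
      exact ENNReal.ofReal_le_ofReal (sub_le_sub_right (monotone_greedy v t s hmn) _)
  have hle : ∀ s, envelope (fun s => (l s : EReal)) p s lam ≤ (l s : EReal) + h s := by
    intro s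
    rcases eq_or_ne (h s) ∞ with htop | htop
    · rw [htop, EReal.coe_ennreal_top, EReal.add_top_of_ne_bot (EReal.coe_ne_bot _)]
      exact le_top
    refine iSup_le fun s' => ?_
    -- `v s s'` is a continuous function of the graph point `(s', l s')`, so the bound at the
    -- candidates `t k` suffices.
    have h1 : v s s' ≤ l s + (h s).toReal := by
      refine ht (fun x => x.2 - lam * |s - x.1| ^ p)
        (by fun_prop (disch := simp [hp.le])) _ (fun k => ?_) s'
      obtain ⟨n, hn⟩ := exists_le_greedy v t s k
      have h2 : ENNReal.ofReal (v s (T n s) - l s) ≤ h s :=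
        le_iSup (fun n => ENNReal.ofReal (v s (T n s) - l s)) n
      have h3 := (ENNReal.ofReal_le_iff_le_toReal htop).1 h2
      change v s (t k) ≤ _
      simp only [T] at *
      linarith
    rw [← EReal.coe_toReal (x := ((h s : ℝ≥0∞) : EReal)) (by simpa using htop)
      (EReal.coe_ennreal_ne_bot _), EReal.toReal_coe_ennreal]
    exact EReal.coe_le_coe_iff.2 h1
  have hb : ∫ s, l s ∂ρ ≤ K := by
    have := hvle 0
    simpa only [hv0] using this
  refine (expectation_le_add_lintegral
    (measurable_envelope _ (fun s => ⟨EReal.coe_ne_bot _, EReal.coe_ne_top _⟩) hp.le lam)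
    hlm.coe_real_ereal hle (lintegral_toENNReal_neg_ne_top hl)).trans ?_
  rw [expectation_coe hl]
  refine (add_le_add_right (EReal.coe_ennreal_le_coe_ennreal_iff.2 hh) _).trans ?_
  rw [EReal.coe_ennreal_ofReal, max_eq_left (by linarith), ← EReal.coe_add]
  exact EReal.coe_le_coe_iff.2 (by linarith)

/-! ### Dual norms -/

section DualNorm

variable {d : ℕ} {N : Seminorm ℝ (EuclideanSpace ℝ (Fin d))}

lemma continuous_seminorm (N : Seminorm ℝ (EuclideanSpace ℝ (Fin d))) : Continuous N :=
  N.convexOn.locallyLipschitz.continuous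

/-- `N` has a positive minimum on the Euclidean unit sphere, which bounds its unit ball. The sphere
is empty when `d = 0`. -/
lemma isCompact_seminorm_closedBall (hN : ∀ x, N x = 0 → x = 0) : IsCompact {x | N x ≤ 1} := by
  refine Metric.isCompact_of_isClosed_isBounded
    (isClosed_le (continuous_seminorm N) continuous_const) ?_
  rcases (Metric.sphere (0 : EuclideanSpace ℝ (Fin d)) 1).eq_empty_or_nonempty with he | hne
  · refine (Metric.isBounded_closedBall (x := (0 : EuclideanSpace ℝ (Fin d))) (r := 0)).subset
      fun x _ => ?_
    by_contra hx
    have hx0 : x ≠ 0 := by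
      rintro rfl
      simp at hx
    have : ‖x‖⁻¹ • x ∈ Metric.sphere (0 : EuclideanSpace ℝ (Fin d)) 1 := by
      simp [norm_smul, hx0]
    rw [he] at this
    exact this
  · obtain ⟨y, hy, hmin⟩ := (isCompact_sphere (0 : EuclideanSpace ℝ (Fin d)) 1).exists_isMinOn hne
      (continuous_seminorm N).continuousOn
    have hy0 : 0 < N y := by
      refine lt_of_le_of_ne (apply_nonneg N y) fun h => ?_
      rw [hN y h.symm] at hy
      simp at hy
    refine (Metric.isBounded_closedBall (x := (0 : EuclideanSpace ℝ (Fin d)))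
      (r := (N y)⁻¹)).subset fun x hx => ?_
    rw [mem_closedBall_zero_iff]
    rcases eq_or_ne x 0 with rfl | hx0
    · simp [hy0.le]
    have h1 : N y ≤ N (‖x‖⁻¹ • x) := hmin (by simp [norm_smul, hx0])
    rw [map_smul_eq_mul, norm_inv, norm_norm, ← div_eq_inv_mul,
      le_div_iff₀ (norm_pos_iff.2 hx0)] at h1
    rw [← one_div, le_div_iff₀ hy0, mul_comm]
    exact h1.trans hx

lemma exists_inner_eq_dualNorm (hN : ∀ x, N x = 0 → x = 0) (θ : EuclideanSpace ℝ (Fin d)) :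
    ∃ w, N w ≤ 1 ∧ ⟪w, θ⟫_ℝ = dualNorm N θ ∧ ∀ x, N x ≤ 1 → ⟪x, θ⟫_ℝ ≤ dualNorm N θ := by
  obtain ⟨w, hw, hmax⟩ := (isCompact_seminorm_closedBall hN).exists_isMaxOn
    ⟨0, by simp⟩ (f := fun x => ⟪x, θ⟫_ℝ) (by fun_prop)
  have hlub : IsGreatest {r : ℝ | ∃ x : EuclideanSpace ℝ (Fin d), N x ≤ 1 ∧ r = ⟪x, θ⟫_ℝ}
      ⟪w, θ⟫_ℝ := by
    refine ⟨⟨w, hw, rfl⟩, ?_⟩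
    rintro _ ⟨x, hx, rfl⟩
    exact hmax hx
  have : ⟪w, θ⟫_ℝ = dualNorm N θ := hlub.csSup_eq.symm
  exact ⟨w, hw, this, fun x hx => this ▸ hmax hx⟩

lemma dualNorm_nonneg (hN : ∀ x, N x = 0 → x = 0) (θ : EuclideanSpace ℝ (Fin d)) :
    0 ≤ dualNorm N θ := by
  obtain ⟨w, _, _, h⟩ := exists_inner_eq_dualNorm hN θ
  simpa using h 0 (by simp)

lemma inner_le_dualNorm_mul (hN : ∀ x, N x = 0 → x = 0) (θ x : EuclideanSpace ℝ (Fin d)) :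
    ⟪θ, x⟫_ℝ ≤ dualNorm N θ * N x := by
  obtain ⟨w, _, _, h⟩ := exists_inner_eq_dualNorm hN θ
  rcases eq_or_ne (N x) 0 with h0 | h0
  · simp [hN x h0]
  have hpos : 0 < N x := lt_of_le_of_ne (apply_nonneg N x) h0.symm
  have := h ((N x)⁻¹ • x) (by
    rw [map_smul_eq_mul, norm_inv, Real.norm_of_nonneg hpos.le, inv_mul_cancel₀ h0])
  rw [real_inner_smul_left, ← div_eq_inv_mul, div_le_iff₀ hpos] at this
  rwa [real_inner_comm]

lemma abs_inner_le_dualNorm_mul (hN : ∀ x, N x = 0 → x = 0) (θ x : EuclideanSpace ℝ (Fin d)) :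
    |⟪θ, x⟫_ℝ| ≤ dualNorm N θ * N x := by
  refine abs_le'.2 ⟨inner_le_dualNorm_mul hN θ x, ?_⟩
  have := inner_le_dualNorm_mul hN θ (-x)
  rwa [inner_neg_right, map_neg_eq_map] at this

lemma dualNorm_pos (hN : ∀ x, N x = 0 → x = 0) {θ : EuclideanSpace ℝ (Fin d)} (hθ : θ ≠ 0) :
    0 < dualNorm N θ := by
  have h := inner_le_dualNorm_mul hN θ θ
  have h1 : 0 < ⟪θ, θ⟫_ℝ := real_inner_self_pos.2 hθ
  exact pos_of_mul_pos_left (h1.trans_le h) (apply_nonneg N θ)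

lemma dualNorm_zero (hN : ∀ x, N x = 0 → x = 0) : dualNorm N 0 = 0 := by
  obtain ⟨w, _, h, _⟩ := exists_inner_eq_dualNorm hN 0
  simpa using h.symm

end DualNorm

/-! ### Supergradients of planar convex sets -/

/-- `lam` is the supremum of `0` and the slopes from `(ε, V)` to points of `S` on the right. Slopes
from the left bound it above, and `(0, b₀)` supplies one. -/
lemma exists_supergradient {S : Set (ℝ × ℝ)} (hS : Convex ℝ S) {b₀ : ℝ} (h0 : (0, b₀) ∈ S)
    {ε V : ℝ} (hε : 0 < ε) (hV : ∀ x ∈ S, x.1 ≤ ε → x.2 ≤ V) :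
    ∃ lam, 0 ≤ lam ∧ ∀ x ∈ S, x.2 ≤ V + lam * (x.1 - ε) := by
  have hcross : ∀ x ∈ S, ∀ y ∈ S, x.1 < ε → ε < y.1 →
      (y.2 - V) / (y.1 - ε) ≤ (V - x.2) / (ε - x.1) := by
    intro x hx y hy hxε hyε
    have hxy : 0 < y.1 - x.1 := by linarith
    -- The weights put the convex combination at abscissa exactly `ε`.
    have hm := hS hx hy (a := (y.1 - ε) / (y.1 - x.1)) (b := (ε - x.1) / (y.1 - x.1))
      (div_nonneg (by linarith) hxy.le) (div_nonneg (by linarith) hxy.le)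
      (by rw [← add_div, div_eq_one_iff_eq hxy.ne']; ring)
    have h1 := hV _ hm (by
      simp only [Prod.fst_add, Prod.smul_fst, smul_eq_mul]
      rw [div_mul_eq_mul_div, div_mul_eq_mul_div, ← add_div, div_le_iff₀ hxy]
      linarith)
    simp only [Prod.snd_add, Prod.smul_snd, smul_eq_mul] at h1
    rw [div_mul_eq_mul_div, div_mul_eq_mul_div, ← add_div, div_le_iff₀ hxy] at h1
    rw [div_le_div_iff₀ (by linarith) (by linarith)]
    linarith
  let R := insert 0 {r : ℝ | ∃ y ∈ S, ε < y.1 ∧ r = (y.2 - V) / (y.1 - ε)}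
  have hRub : ∀ x ∈ S, x.1 < ε → (V - x.2) / (ε - x.1) ∈ upperBounds R := by
    intro x hx hxε r hr
    rcases hr with rfl | ⟨y, hy, hyε, rfl⟩
    · exact div_nonneg (by linarith [hV x hx hxε.le]) (by linarith)
    · exact hcross x hx y hy hxε hyε
  have hbdd : BddAbove R := ⟨_, hRub _ h0 hε⟩
  refine ⟨sSup R, le_csSup hbdd (Set.mem_insert _ _), fun x hx => ?_⟩
  rcases lt_trichotomy x.1 ε with hlt | heq | hgt
  · have h1 := csSup_le ⟨0, Set.mem_insert _ _⟩ (hRub x hx hlt)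
    rw [le_div_iff₀ (by linarith)] at h1
    linarith
  · have := hV x hx heq.le
    simpa [heq] using this
  · have h1 := le_csSup hbdd (Set.mem_insert_of_mem _ ⟨x, hx, hgt, rfl⟩)
    rw [div_le_iff₀ (by linarith)] at h1
    linarith

/-! ### Strong duality -/

section StrongDuality

variable {d : ℕ}

/-- The pairs of a transportation budget and an expected loss that are attained by a joint
distribution with second marginal `P`. -/
def achievable (N : Seminorm ℝ (EuclideanSpace ℝ (Fin d))) (p : ℝ) (θ : EuclideanSpace ℝ (Fin d))
    (l : ℝ → ℝ) (P : Measure (EuclideanSpace ℝ (Fin d))) : Set (ℝ × ℝ) :=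
  {x | ∃ π : Measure (EuclideanSpace ℝ (Fin d) × EuclideanSpace ℝ (Fin d)),
    IsProbabilityMeasure π ∧ π.map Prod.snd = P ∧ 0 ≤ x.1 ∧
    ∫⁻ w, normCost N p w.1 w.2 ∂π ≤ ENNReal.ofReal x.1 ∧
    Integrable (fun w => l ⟪θ, w.1⟫_ℝ) π ∧ ∫ w, l ⟪θ, w.1⟫_ℝ ∂π = x.2}

variable {N : Seminorm ℝ (EuclideanSpace ℝ (Fin d))} {p : ℝ} {θ : EuclideanSpace ℝ (Fin d)}
  {l : ℝ → ℝ}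

lemma convex_achievable (P : Measure (EuclideanSpace ℝ (Fin d))) :
    Convex ℝ (achievable N p θ l P) := by
  rintro x ⟨π₁, hπ₁, hs₁, hx₁, hc₁, hi₁, he₁⟩ y ⟨π₂, hπ₂, hs₂, hx₂, hc₂, hi₂, he₂⟩ a b ha hb hab
  have habE : ENNReal.ofReal a + ENNReal.ofReal b = 1 := by
    rw [← ENNReal.ofReal_add ha hb, hab, ENNReal.ofReal_one]
  refine ⟨ENNReal.ofReal a • π₁ + ENNReal.ofReal b • π₂, ⟨by simpa using habE⟩, ?_, ?_, ?_, ?_, ?_⟩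
  · rw [Measure.map_add _ _ measurable_snd, Measure.map_smul, Measure.map_smul, hs₁, hs₂, ← add_smul,
      habE, one_smul]
  · simp only [Prod.fst_add, Prod.smul_fst, smul_eq_mul]
    positivity
  · simp only [Prod.fst_add, Prod.smul_fst, smul_eq_mul]
    rw [lintegral_add_measure, lintegral_smul_measure, lintegral_smul_measure,
      ENNReal.ofReal_add (by positivity) (by positivity), ENNReal.ofReal_mul ha,
      ENNReal.ofReal_mul hb, smul_eq_mul, smul_eq_mul]
    gcongr
  · exact (hi₁.smul_measure ENNReal.ofReal_ne_top).add_measure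
      (hi₂.smul_measure ENNReal.ofReal_ne_top)
  · rw [integral_add_measure (hi₁.smul_measure ENNReal.ofReal_ne_top)
      (hi₂.smul_measure ENNReal.ofReal_ne_top), integral_smul_measure, integral_smul_measure,
      he₁, he₂, ENNReal.toReal_ofReal ha, ENNReal.toReal_ofReal hb]
    rfl

lemma measurable_normCost (hp : 0 ≤ p) :
    Measurable fun w : EuclideanSpace ℝ (Fin d) × EuclideanSpace ℝ (Fin d) =>
      normCost N p w.1 w.2 := by
  have h : Continuous fun w : EuclideanSpace ℝ (Fin d) × EuclideanSpace ℝ (Fin d) =>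
      N (w.1 - w.2) ^ p :=
    ((continuous_seminorm N).comp (continuous_fst.sub continuous_snd)).rpow_const
      fun _ => Or.inr hp
  exact h.measurable.ennreal_ofReal

lemma measurable_inner_left (θ : EuclideanSpace ℝ (Fin d)) :
    Measurable fun z : EuclideanSpace ℝ (Fin d) => ⟪θ, z⟫_ℝ :=
  (continuous_const.inner continuous_id).measurable

/-- Displacing `P` along a direction that attains the dual norm. -/
lemma mem_achievable_of_map (hN : ∀ x, N x = 0 → x = 0) (hθ : θ ≠ 0) (hp : 1 ≤ p)
    (hlm : Measurable l) (P : ProbabilityMeasure (EuclideanSpace ℝ (Fin d))) {T : ℝ → ℝ}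
    (hT : Measurable T)
    (hl : Integrable (fun s => l (T s))
      ((P : Measure (EuclideanSpace ℝ (Fin d))).map fun z => ⟪θ, z⟫_ℝ))
    (hc : Integrable (fun s => |s - T s| ^ p)
      ((P : Measure (EuclideanSpace ℝ (Fin d))).map fun z => ⟪θ, z⟫_ℝ)) :
    ((∫ s, |s - T s| ^ p ∂((P : Measure (EuclideanSpace ℝ (Fin d))).map fun z => ⟪θ, z⟫_ℝ))
        / dualNorm N θ ^ p,
      ∫ s, l (T s) ∂((P : Measure (EuclideanSpace ℝ (Fin d))).map fun z => ⟪θ, z⟫_ℝ)) ∈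
      achievable N p θ l P := by
  have hi := measurable_inner_left θ
  have hD := dualNorm_pos hN hθ
  obtain ⟨w, hw, hwD, -⟩ := exists_inner_eq_dualNorm hN θ
  set D := dualNorm N θ
  -- Since `⟪w, θ⟫ = D` and `N w ≤ 1`, this shift changes the scalar product into its image under
  -- `T` and has `N`-length at most `|T s - s| / D`.
  let F : EuclideanSpace ℝ (Fin d) → EuclideanSpace ℝ (Fin d) :=
    fun z => z + ((T ⟪θ, z⟫_ℝ - ⟪θ, z⟫_ℝ) / D) • w
  have hF : Measurable F :=
    measurable_id.add ((((hT.comp hi).sub hi).div_const D).smul_const w)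
  have hFi : ∀ z, ⟪θ, F z⟫_ℝ = T ⟪θ, z⟫_ℝ := fun z => by
    simp only [F]
    rw [inner_add_right, real_inner_smul_right, real_inner_comm w θ, hwD,
      div_mul_cancel₀ _ hD.ne']
    ring
  have hG : Measurable fun z => (F z, z) := hF.prodMk measurable_id
  have hlθ : Measurable fun x : EuclideanSpace ℝ (Fin d) × EuclideanSpace ℝ (Fin d) =>
      l ⟪θ, x.1⟫_ℝ := hlm.comp (hi.comp measurable_fst)
  have hcm : Integrable (fun z => |⟪θ, z⟫_ℝ - T ⟪θ, z⟫_ℝ| ^ p / D ^ p)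
      (P : Measure (EuclideanSpace ℝ (Fin d))) := (hc.comp_measurable hi).div_const _
  refine ⟨(P : Measure (EuclideanSpace ℝ (Fin d))).map fun z => (F z, z),
    Measure.isProbabilityMeasure_map hG.aemeasurable, ?_, ?_, ?_, ?_, ?_⟩
  · rw [Measure.map_map measurable_snd hG]
    exact Measure.map_id
  · exact div_nonneg (integral_nonneg fun s => by positivity) (by positivity)
  · rw [lintegral_map (measurable_normCost (by linarith)) hG, integral_map hi.aemeasurable
      hc.aestronglyMeasurable, ← integral_div, ofReal_integral_eq_lintegral_ofReal
      hcm (Filter.Eventually.of_forall fun z => by simp only [Pi.zero_apply]; positivity)]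
    refine lintegral_mono fun z => ENNReal.ofReal_le_ofReal ?_
    rw [← Real.div_rpow (abs_nonneg _) hD.le]
    refine Real.rpow_le_rpow (apply_nonneg N _) ?_ (by linarith)
    simp only [F, add_sub_cancel_left]
    rw [map_smul_eq_mul, Real.norm_eq_abs, abs_div, abs_of_pos hD, abs_sub_comm]
    exact mul_le_of_le_one_right (by positivity) hw
  · rw [integrable_map_measure hlθ.aestronglyMeasurable hG.aemeasurable]
    refine (hl.comp_measurable hi).congr (Filter.Eventually.of_forall fun z => ?_)
    simp [hFi]
  · rw [integral_map hG.aemeasurable hlθ.aestronglyMeasurable, integral_map hi.aemeasurable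
      hl.aestronglyMeasurable]
    simp [hFi]

lemma coe_le_iSup_of_mem_achievable (hlm : Measurable l)
    {P : ProbabilityMeasure (EuclideanSpace ℝ (Fin d))} {ε : ℝ} {x : ℝ × ℝ}
    (hx : x ∈ achievable N p θ l P) (hxε : x.1 ≤ ε) :
    (x.2 : EReal) ≤ ⨆ Q ∈ ambiguitySet (normCost N p) P ε,
      expectation (Q : Measure (EuclideanSpace ℝ (Fin d))) (fun z => (l ⟪θ, z⟫_ℝ : EReal)) := by
  obtain ⟨π, hπ, hs, -, hc, hi, he⟩ := hx
  have hl : Measurable fun z : EuclideanSpace ℝ (Fin d) => l ⟪θ, z⟫_ℝ :=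
    hlm.comp (measurable_inner_left θ)
  let Q : ProbabilityMeasure (EuclideanSpace ℝ (Fin d)) :=
    ⟨π.map Prod.fst, Measure.isProbabilityMeasure_map measurable_fst.aemeasurable⟩
  have hQ : Q ∈ ambiguitySet (normCost N p) P ε := by
    have hπm : (⟨π, hπ⟩ : ProbabilityMeasure _) ∈ couplings Q P := ⟨rfl, hs⟩
    have h1 : otDiscrepancy (normCost N p) Q P ≤ ∫⁻ w, normCost N p w.1 w.2 ∂π :=
      iInf₂_le (⟨π, hπ⟩ : ProbabilityMeasure _) hπm
    exact h1.trans (hc.trans (ENNReal.ofReal_le_ofReal hxε))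
  refine le_trans (le_of_eq ?_) (le_iSup₂ Q hQ)
  change _ = expectation (π.map Prod.fst) _
  rw [expectation_coe ((integrable_map_measure hl.aestronglyMeasurable
    measurable_fst.aemeasurable).2 hi), integral_map measurable_fst.aemeasurable
    hl.aestronglyMeasurable, he]

/-- The diagonal coupling shows that `P` itself competes, so the primal value is not `⊥`. -/
lemma coe_integral_le_iSup (hp : 1 ≤ p) (hlm : Measurable l)
    {P : ProbabilityMeasure (EuclideanSpace ℝ (Fin d))} {ε : ℝ} (hε : 0 < ε)
    (hl : Integrable (fun z => l ⟪θ, z⟫_ℝ) (P : Measure (EuclideanSpace ℝ (Fin d)))) :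
    ((∫ z, l ⟪θ, z⟫_ℝ ∂(P : Measure (EuclideanSpace ℝ (Fin d))) : ℝ) : EReal) ≤
      ⨆ Q ∈ ambiguitySet (normCost N p) P ε,
      expectation (Q : Measure (EuclideanSpace ℝ (Fin d))) (fun z => (l ⟪θ, z⟫_ℝ : EReal)) := by
  have hG : Measurable fun z : EuclideanSpace ℝ (Fin d) => (z, z) :=
    measurable_id.prodMk measurable_id
  have hlθ : Measurable fun x : EuclideanSpace ℝ (Fin d) × EuclideanSpace ℝ (Fin d) =>
      l ⟪θ, x.1⟫_ℝ := hlm.comp ((measurable_inner_left θ).comp measurable_fst)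
  refine coe_le_iSup_of_mem_achievable (x := (0, _)) hlm
    ⟨(P : Measure (EuclideanSpace ℝ (Fin d))).map fun z => (z, z),
      Measure.isProbabilityMeasure_map hG.aemeasurable, ?_, le_rfl, ?_, ?_, ?_⟩ hε.le
  · rw [Measure.map_map measurable_snd hG]
    exact Measure.map_id
  · rw [lintegral_map (measurable_normCost (by linarith)) hG]
    simp [normCost, Real.zero_rpow (by linarith : p ≠ 0)]
  · exact (integrable_map_measure hlθ.aestronglyMeasurable hG.aemeasurable).2 hl
  · exact integral_map hG.aemeasurable hlθ.aestronglyMeasurable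

theorem iInf_dual_le_of_ne_zero (hN : ∀ x, N x = 0 → x = 0) (hθ : θ ≠ 0) (hp : 1 ≤ p)
    (hlm : Measurable l) {P : ProbabilityMeasure (EuclideanSpace ℝ (Fin d))} {ε : ℝ} (hε : 0 < ε)
    (hl : Integrable (fun z => l ⟪θ, z⟫_ℝ) (P : Measure (EuclideanSpace ℝ (Fin d)))) :
    (⨅ (lam : ℝ) (_ : 0 ≤ lam), ((lam * ε * dualNorm N θ ^ p : ℝ) : EReal) +
      expectation (P : Measure (EuclideanSpace ℝ (Fin d)))
        (fun z => envelope (fun s => (l s : EReal)) p ⟪θ, z⟫_ℝ lam)) ≤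
    ⨆ Q ∈ ambiguitySet (normCost N p) P ε,
      expectation (Q : Measure (EuclideanSpace ℝ (Fin d))) (fun z => (l ⟪θ, z⟫_ℝ : EReal)) := by
  have hp0 : 0 < p := by linarith
  have hi := measurable_inner_left θ
  have hD := dualNorm_pos hN hθ
  have hach := fun x hx => coe_le_iSup_of_mem_achievable (N := N) (p := p) (θ := θ) (P := P)
    (ε := ε) (x := x) hlm hx
  have hbase := coe_integral_le_iSup (N := N) hp hlm hε hl
  generalize (⨆ Q ∈ ambiguitySet (normCost N p) P ε,
      expectation (Q : Measure (EuclideanSpace ℝ (Fin d))) (fun z => (l ⟪θ, z⟫_ℝ : EReal))) = W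
    at *
  induction W with
  | bot => exact absurd hbase (EReal.bot_lt_coe _).not_ge
  | top => exact le_top
  | coe V =>
    set ρ := (P : Measure (EuclideanSpace ℝ (Fin d))).map fun z => ⟪θ, z⟫_ℝ with hρ
    have : IsProbabilityMeasure ρ := Measure.isProbabilityMeasure_map hi.aemeasurable
    have hlρ : Integrable l ρ := (integrable_map_measure hlm.aestronglyMeasurable
      hi.aemeasurable).2 hl
    have h0 : (0, ∫ s, l s ∂ρ) ∈ achievable N p θ l P := by
      have := mem_achievable_of_map hN hθ hp hlm P measurable_id hlρ
        (by simp [Real.zero_rpow hp0.ne'])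
      simpa [Real.zero_rpow hp0.ne'] using this
    obtain ⟨lam, hlam, hsup⟩ := exists_supergradient (convex_achievable _) h0 hε
      (V := V) fun x hx hxε => EReal.coe_le_coe_iff.1 (hach x hx hxε)
    have hDp : 0 < dualNorm N θ ^ p := by positivity
    -- The slope `lam` prices the cost in `ℝ^d`; dividing by `D ^ p` prices the scalar displacement.
    refine (iInf₂_le (lam / dualNorm N θ ^ p) (by positivity)).trans ?_
    have hE : expectation ρ
        (fun s => envelope (fun s => (l s : EReal)) p s (lam / dualNorm N θ ^ p)) ≤
        ((V - lam * ε : ℝ) : EReal) := by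
      refine expectation_envelope_le hlm hlρ hp0 _ _ fun T hT ⟨M, hM⟩ hTl => ?_
      have := hsup _ (mem_achievable_of_map hN hθ hp hlm P hT hTl
        (integrable_abs_sub_rpow hT hM hp0.le))
      simp only at this
      rw [div_mul_eq_mul_div, mul_div_assoc]
      linarith
    rw [hρ, expectation_map hi (measurable_envelope _
      (fun s => ⟨EReal.coe_ne_bot _, EReal.coe_ne_top _⟩) hp0.le _)] at hE
    refine (add_le_add_right hE _).trans ?_
    rw [← EReal.coe_add, EReal.coe_le_coe_iff]
    have : lam / dualNorm N θ ^ p * ε * dualNorm N θ ^ p = lam * ε := by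
      field_simp
    linarith

lemma exists_envelope_zero_le {L : ℝ → EReal} (hp : 0 < p) (hLusc : UpperSemicontinuous L)
    {C : ℝ} (hgrowth : ∀ s : ℝ, L s ≤ ((C * (1 + |s| ^ p) : ℝ) : EReal)) {a : ℝ}
    (ha : L 0 < a) : ∃ lam, 0 ≤ lam ∧ envelope L p 0 lam ≤ a := by
  obtain ⟨δ, hδ, hball⟩ := Metric.eventually_nhds_iff.1 (hLusc 0 a ha)
  have hδp : 0 < δ ^ p := by positivity
  -- For `|s| ≥ δ` the term `|C|` absorbs `C * |s| ^ p` and the other absorbs `C - a`; for `|s| < δ`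
  -- semicontinuity already gives `L s < a`.
  refine ⟨|C| + |C - a| / δ ^ p, by positivity, iSup_le fun s => ?_⟩
  rw [zero_sub, abs_neg]
  rcases lt_or_ge |s| δ with hs | hs
  · refine le_trans ?_ (hball (by simpa using hs)).le
    exact (EReal.sub_le_sub le_rfl (EReal.coe_le_coe_iff.2
      (show (0 : ℝ) ≤ _ by positivity))).trans (by simp)
  · refine (EReal.sub_le_sub (hgrowth s) le_rfl).trans ?_
    rw [← EReal.coe_sub, EReal.coe_le_coe_iff]
    have h1 : δ ^ p ≤ |s| ^ p := Real.rpow_le_rpow hδ.le hs hp.le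
    have h2 : |C - a| ≤ |C - a| / δ ^ p * |s| ^ p := by
      rw [div_mul_eq_mul_div, le_div_iff₀ hδp]
      gcongr
    have h3 : C * |s| ^ p ≤ |C| * |s| ^ p := by
      gcongr
      exact le_abs_self C
    nlinarith [le_abs_self (C - a)]

end StrongDuality

end DRO

theorem proposition3p7 {d : ℕ}
    -- an arbitrary norm on `ℝ^d`
    (N : Seminorm ℝ (EuclideanSpace ℝ (Fin d))) (hN : ∀ x, N x = 0 → x = 0)
    (p : ℝ) (hp : 1 ≤ p)
    (L : ℝ → EReal) (hLproper : DRO.IsProper L) (hLusc : UpperSemicontinuous L)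
    (C : ℝ) (hC : 0 ≤ C) (hgrowth : ∀ s : ℝ, L s ≤ ((C * (1 + |s| ^ p) : ℝ) : EReal))
    (P : ProbabilityMeasure (EuclideanSpace ℝ (Fin d)))
    (ε : ℝ) (hε : 0 < ε)
    (θ : EuclideanSpace ℝ (Fin d))
    (hint : DRO.IsIntegrable (P : Measure (EuclideanSpace ℝ (Fin d))) (fun z => L ⟪θ, z⟫_ℝ)) :
    (⨆ Q ∈ DRO.ambiguitySet (DRO.normCost N p) P ε,
        DRO.expectation (Q : Measure (EuclideanSpace ℝ (Fin d))) (fun z => L ⟪θ, z⟫_ℝ)) =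
      ⨅ (lam : ℝ) (_ : 0 ≤ lam),
        ((lam * ε * DRO.dualNorm N θ ^ p : ℝ) : EReal) +
          DRO.expectation (P : Measure (EuclideanSpace ℝ (Fin d)))
            (fun z => DRO.envelope L p ⟪θ, z⟫_ℝ lam) := by

  have hLb : ∀ s, L s ≠ ⊥ ∧ L s ≠ ⊤ := fun s =>
    ⟨hLproper.1 s, ne_top_of_le_ne_top (EReal.coe_ne_top _) (hgrowth s)⟩
  obtain ⟨l, rfl⟩ : ∃ l : ℝ → ℝ, L = fun s => (l s : EReal) :=
    ⟨fun s => (L s).toReal, funext fun s => (EReal.coe_toReal (hLb s).2 (hLb s).1).symm⟩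
  have hLm : Measurable fun s => (l s : EReal) := hLusc.measurable
  have hlm : Measurable l := by simpa using hLm.ereal_toReal
  have hl : Integrable (fun z => l ⟪θ, z⟫_ℝ) (P : Measure (EuclideanSpace ℝ (Fin d))) := by
    refine ⟨(hlm.comp (DRO.measurable_inner_left θ)).aestronglyMeasurable, ?_⟩
    rw [hasFiniteIntegral_iff_norm]
    simpa only [EReal.abs_def, Real.norm_eq_abs] using hint.2
  refine le_antisymm (iSup₂_le fun Q hQ => le_iInf₂ fun lam hlam => ?_) ?_
  · exact DRO.expectation_le_of_mem_ambiguitySet hp (DRO.dualNorm_nonneg hN θ)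
      (DRO.abs_inner_le_dualNorm_mul hN θ) hLb hLm hlam hε
      (DRO.lintegral_toENNReal_neg_ne_top hl) hQ
  · rcases eq_or_ne θ 0 with rfl | hθ
    · refine le_trans ?_ (DRO.coe_integral_le_iSup hp hlm hε hl)
      -- The right-hand side is now `l 0`, so it suffices to bound the dual value by every real `a >
      -- l 0`.
      refine EReal.le_of_forall_lt_iff_le.1 fun a ha => ?_
      simp only [inner_zero_left, integral_const, probReal_univ, one_smul] at ha
      obtain ⟨lam, hlam, hle⟩ := DRO.exists_envelope_zero_le (by linarith) hLusc hgrowth ha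
      refine (iInf₂_le lam hlam).trans ?_
      rw [DRO.dualNorm_zero hN, Real.zero_rpow (by linarith), mul_zero, EReal.coe_zero, zero_add]
      have ha' : Integrable (fun _ : EuclideanSpace ℝ (Fin d) => a)
        (P : Measure (EuclideanSpace ℝ (Fin d))) := integrable_const a
      have := DRO.expectation_le_add_lintegral (μ := (P : Measure (EuclideanSpace ℝ (Fin d))))
        (f := fun z => DRO.envelope (fun s => (l s : EReal)) p ⟪0, z⟫_ℝ lam)
        (g := fun _ => (a : EReal)) (h := fun _ => 0)
        (by simp only [inner_zero_left]; exact measurable_const) measurable_const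
        (fun z => by simpa using hle) (DRO.lintegral_toENNReal_neg_ne_top ha')
      rw [DRO.expectation_coe ha'] at this
      simpa using this
    · exact DRO.iInf_dual_le_of_ne_zero hN hθ hp hlm hε hl
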